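/- Let $k$ be an algebraically closed field, let $n\ge 4$, and let $\Gamma\subset\mathbb{P}^n_k$ be a set of $n+3$ distinct points in general linear position, i.e. no $n+1$ points of $\Gamma$ lie on a common hyperplane. Let $J=\bigcap_{p\in\Gamma}I(p)\subset R=k[x_0,\ldots,x_n]$ be the homogeneous defining ideal of $\Gamma$, let $\Theta=(\partial g_i/\partial x_j)$ be the Jacobian matrix of a finite set of generators $g_1,\ldots,g_m$ of $J$, and let $I=(J,I_n(\Theta))$ be the Jacobian ideal of $J$, where $I_n(\Theta)$ is the ideal generated by the $n$-minors of $\Theta$. Then the pair $J\subset I$ is Aluffi torsion-free: its Valabrega--Valla module $$\bigoplus_{t\ge 2}\frac{J\cap I^t}{J\,I^{t-1}}$$ is zero. -/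

import Mathlib

open scoped LinearAlgebra.Projectivization

noncomputable section

namespace AluffiPoints

/-- A finite set `Γ` of points of `ℙⁿ` is in general linear position if either `|Γ| ≤ n` and the
points span a linear subspace of projective dimension `|Γ| - 1`, or `|Γ| ≥ n + 1` and no `n + 1`
points of `Γ` lie on a common hyperplane (the zero locus of a nonzero linear form). -/
def InGeneralLinearPosition {k : Type*} [Field k] {n : ℕ}
    (Γ : Finset (ℙ k (Fin (n + 1) → k))) : Prop :=
  (Γ.card ≤ n ∧
    Module.finrank k (⨆ p ∈ Γ, p.submodule : Submodule k (Fin (n + 1) → k)) = Γ.card) ∨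
  (n + 1 ≤ Γ.card ∧
    ∀ S ⊆ Γ, S.card = n + 1 →
      ¬ ∃ l : Module.Dual k (Fin (n + 1) → k), l ≠ 0 ∧ ∀ p ∈ S, p.submodule ≤ LinearMap.ker l)

/-- The homogeneous ideal `I(p)` of a point `p ∈ ℙⁿ`: the ideal of `k[x₀,…,xₙ]` generated by the
homogeneous polynomials that vanish at `p`. -/
def pointIdeal {k : Type*} [Field k] {n : ℕ} (p : ℙ k (Fin (n + 1) → k)) :
    Ideal (MvPolynomial (Fin (n + 1)) k) :=
  Ideal.span {f | (∃ d : ℕ, f.IsHomogeneous d) ∧ MvPolynomial.eval p.rep f = 0}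

/-- The defining ideal `⋂ I(p)` of a finite set of points. -/
def definingIdeal {k : Type*} [Field k] {n : ℕ} (Γ : Finset (ℙ k (Fin (n + 1) → k))) :
    Ideal (MvPolynomial (Fin (n + 1)) k) :=
  ⨅ p ∈ Γ, pointIdeal p

/-- The Jacobian matrix `(∂gᵢ/∂xⱼ)` of a family of polynomials. -/
def jacobianMatrix {k : Type*} [CommRing k] {ι σ : Type*} (g : ι → MvPolynomial σ k) :
    Matrix ι σ (MvPolynomial σ k) :=
  Matrix.of fun i j => MvPolynomial.pderiv j (g i)

/-- The ideal `I_r(A)` generated by the `r`-minors of `A`. Rows and columns are picked by arbitrary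
maps: a repeated row or column gives the determinant `0` and a reordering only changes the sign,
so the ideal is the usual one. -/
def minorsIdeal {R : Type*} [CommRing R] {ι κ : Type*} (r : ℕ) (A : Matrix ι κ R) : Ideal R :=
  Ideal.span {d | ∃ (e : Fin r → ι) (f : Fin r → κ), d = (A.submatrix e f).det}

/-- The Valabrega–Valla module `⨁_{t ≥ 2} (J ∩ Iᵗ) / (J Iᵗ⁻¹)` of a pair of ideals `J ⊆ I`. -/
abbrev ValabregaValla {R : Type*} [CommRing R] (J I : Ideal R) : Type _ :=
  DirectSum {t : ℕ // 2 ≤ t} fun t =>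
    (↥(J ⊓ I ^ (t : ℕ)) ⧸ Submodule.submoduleOf (J * I ^ ((t : ℕ) - 1)) (J ⊓ I ^ (t : ℕ)))

/-- A pair of ideals `J ⊆ I` is Aluffi torsion-free if its Valabrega–Valla module is zero. -/
def IsAluffiTorsionFree {R : Type*} [CommRing R] (J I : Ideal R) : Prop :=
  J ≤ I ∧ Subsingleton (ValabregaValla J I)

end AluffiPoints

end

/-!
Let `m` be the irrelevant ideal. Since `Γ` lies on no hyperplane, `J ⊆ m ^ 2`, so the entries of
the Jacobian matrix lie in `m` and its `n`-minors in `m ^ n`. The heart of the proof is that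
`J + I_n(Θ)` is all of `J + m ^ n`. By Lagrange interpolation it suffices to find in `J + I_n(Θ)`,
for each `p ∈ Γ`, a form of degree `n` that vanishes on `Γ \ {p}` but not at `p`. A Jacobian
determinant of `n` quadrics of `J`, bordered by a row of constants, does this: the quadrics are
products of two hyperplanes, chosen so that their gradients at `p` are independent while each of
the other points is a singular point of one of the quadrics or lies on the hyperplane defined by
the bordering row.

Hyperplanes also give separators of degree `n - 1` for the points of `Γ`, and interpolating with
them shows `J ∩ m ^ (n + j) ⊆ J m ^ j`, a weak form of the statement that `J` has regularity at
most `n`. Hence `J ∩ (m ^ n) ^ t = J (m ^ n) ^ (t - 1)`, and the modular law carries this over from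
`m ^ n` to `J + m ^ n`.
-/

noncomputable section

namespace AluffiPoints

open MvPolynomial

section IdealPowers

variable {R : Type*} [CommRing R]

lemma sup_pow_succ_le (J K : Ideal R) (t : ℕ) :
    (J ⊔ K) ^ (t + 1) ≤ J * (J ⊔ K) ^ t ⊔ K ^ (t + 1) := by
  induction t with
  | zero => simp
  | succ t ih =>
    calc (J ⊔ K) ^ (t + 2) = (J ⊔ K) * (J ⊔ K) ^ (t + 1) := pow_succ' _ _
      _ = J * (J ⊔ K) ^ (t + 1) ⊔ K * (J ⊔ K) ^ (t + 1) := Ideal.sup_mul _ _ _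
      _ ≤ J * (J ⊔ K) ^ (t + 1) ⊔ K * (J * (J ⊔ K) ^ t ⊔ K ^ (t + 1)) := by gcongr
      _ = J * (J ⊔ K) ^ (t + 1) ⊔ (J * (K * (J ⊔ K) ^ t) ⊔ K ^ (t + 2)) := by
        rw [Ideal.mul_sup, mul_left_comm, ← pow_succ' K]
      _ ≤ J * (J ⊔ K) ^ (t + 1) ⊔ K ^ (t + 2) := by
        have hK : J * (K * (J ⊔ K) ^ t) ≤ J * (J ⊔ K) ^ (t + 1) := by
          rw [pow_succ' (J ⊔ K)]
          gcongr
          exact le_sup_right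
        exact sup_le le_sup_left (sup_le_sup_right hK _)

lemma isAluffiTorsionFree_of_inf_pow_le {J I : Ideal R} (hJI : J ≤ I)
    (h : ∀ t, J ⊓ I ^ (t + 1) ≤ J * I ^ t) : IsAluffiTorsionFree J I := by
  have (t : {t : ℕ // 2 ≤ t}) : Subsingleton (↥(J ⊓ I ^ (t : ℕ)) ⧸
      Submodule.submoduleOf (J * I ^ ((t : ℕ) - 1)) (J ⊓ I ^ (t : ℕ))) := by
    rw [Submodule.Quotient.subsingleton_iff, Submodule.submoduleOf, Submodule.comap_subtype_eq_top]
    simpa only [Nat.sub_add_cancel (one_le_two.trans t.2)] using h ((t : ℕ) - 1)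
  exact ⟨hJI, ⟨fun x y => DFinsupp.ext fun t => Subsingleton.elim _ _⟩⟩

lemma isAluffiTorsionFree_sup {J K : Ideal R} (h : ∀ t, J ⊓ K ^ (t + 1) ≤ J * K ^ t) :
    IsAluffiTorsionFree J (J ⊔ K) := by
  refine isAluffiTorsionFree_of_inf_pow_le le_sup_left fun t => ?_
  calc J ⊓ (J ⊔ K) ^ (t + 1) ≤ (J * (J ⊔ K) ^ t ⊔ K ^ (t + 1)) ⊓ J := by
        rw [inf_comm]
        exact inf_le_inf_right J (sup_pow_succ_le J K t)
    _ = J * (J ⊔ K) ^ t ⊔ K ^ (t + 1) ⊓ J := sup_inf_assoc_of_le _ Ideal.mul_le_left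
    _ ≤ J * (J ⊔ K) ^ t ⊔ J * K ^ t := sup_le_sup_left (inf_comm J _ ▸ h t) _
    _ = J * (J ⊔ K) ^ t :=
      sup_eq_left.2 (Ideal.mul_mono_right (Ideal.pow_right_mono le_sup_right t))

end IdealPowers

section Minors

variable {R ι κ : Type*} [CommRing R]

lemma minorsIdeal_le_pow {I : Ideal R} {A : Matrix ι κ R} (hA : ∀ i j, A i j ∈ I) (r : ℕ) :
    minorsIdeal r A ≤ I ^ r := by
  refine Ideal.span_le.2 ?_
  rintro _ ⟨e, f, rfl⟩
  rw [Matrix.det_apply]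
  refine Ideal.sum_mem _ fun τ _ => Submodule.smul_of_tower_mem _ _ ?_
  simpa using Ideal.prod_mem_prod (s := Finset.univ) (I := fun _ : Fin r => I)
    (x := fun i => A.submatrix e f (τ i) i) fun i _ => hA _ _

lemma minorsIdeal_map_le {S : Type*} [CommRing S] (φ : R →+* S) (r : ℕ) (A : Matrix ι κ R) :
    minorsIdeal r (A.map φ) ≤ (minorsIdeal r A).map φ := by
  refine Ideal.span_le.2 ?_
  rintro _ ⟨e, f, rfl⟩
  have h := Ideal.mem_map_of_mem φ (Ideal.subset_span ⟨e, f, rfl⟩ :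
    (A.submatrix e f).det ∈ minorsIdeal r A)
  rwa [RingHom.map_det] at h

lemma det_mem_minorsIdeal {r : ℕ} {A : Matrix ι κ R} {N : Matrix (Fin r) (Fin r) R}
    (f : Fin r → κ) (hN : ∀ s, N s ∈ Submodule.span R (Set.range fun i => A i ∘ f)) :
    N.det ∈ minorsIdeal r A := by
  choose a ha using fun s => Finsupp.mem_span_range_iff_exists_finsupp.1 (hN s)
  obtain rfl : (fun s => ∑ i ∈ (a s).support, a s i • (A i ∘ f)) = N := funext ha
  change Matrix.detRowAlternating.toMultilinearMap _ ∈ _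
  rw [MultilinearMap.map_sum_finset]
  refine Ideal.sum_mem _ fun e _ => ?_
  rw [MultilinearMap.map_smul_univ]
  exact Ideal.mul_mem_left _ _ (Ideal.subset_span ⟨e, f, rfl⟩)

lemma derivation_mem_of_mem_sq {k : Type*} [CommRing k] [Algebra k R] (D : Derivation k R R)
    {I : Ideal R} {f : R} (hf : f ∈ I ^ 2) : D f ∈ I := by
  rw [pow_two] at hf
  refine Submodule.mul_induction_on hf (fun a ha b hb => ?_) fun a b ha hb => ?_
  · rw [Derivation.leibniz]
    exact add_mem (I.mul_mem_right _ ha) (I.mul_mem_right _ hb)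
  · rw [map_add]
    exact add_mem ha hb

lemma det_pderiv_mem {σ : Type*} {r : ℕ} (g : ι → MvPolynomial σ R) {Q : Fin r → MvPolynomial σ R}
    (hQ : ∀ s, Q s ∈ Ideal.span (Set.range g)) (c : Fin r → σ) :
    (Matrix.of fun s t => pderiv (c t) (Q s)).det ∈
      Ideal.span (Set.range g) ⊔ minorsIdeal r (jacobianMatrix g) := by
  set J := Ideal.span (Set.range g)
  let π := Ideal.Quotient.mk J
  rw [sup_comm, ← Ideal.mem_quotient_iff_mem_sup, RingHom.map_det]
  refine minorsIdeal_map_le π r _ (det_mem_minorsIdeal c fun s => ?_)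
  -- Modulo `J` the differential is linear on `J`, as `d(af) = a df + f da`.
  change (fun t => π (pderiv (c t) (Q s))) ∈ Submodule.span _ _
  have hQs := hQ s
  generalize Q s = q at hQs ⊢
  induction hQs using Submodule.span_induction with
  | mem _ hf =>
    obtain ⟨i, rfl⟩ := hf
    exact Submodule.subset_span ⟨i, rfl⟩
  | zero =>
    simp only [map_zero]
    exact zero_mem _
  | add f f' _ _ hf hf' => simpa [Pi.add_def] using add_mem hf hf'
  | smul a f hfJ hf =>
    have hf0 : π f = 0 := Ideal.Quotient.eq_zero_iff_mem.2 hfJ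
    simpa [Derivation.leibniz, hf0, Pi.smul_def] using Submodule.smul_mem _ (π a) hf

end Minors

section HomogeneousPolynomials

variable {σ R : Type*} [CommSemiring R]

lemma mem_pow_idealOfVars_iff_homogeneousComponent {f : MvPolynomial σ R} {N : ℕ} :
    f ∈ idealOfVars σ R ^ N ↔ ∀ d < N, homogeneousComponent d f = 0 := by
  rw [mem_pow_idealOfVars_iff']
  constructor
  · intro h d hd
    ext x
    rw [coeff_homogeneousComponent, coeff_zero]
    split_ifs with hx
    · exact h x (hx ▸ hd)
    · rfl
  · intro h x hx
    simpa [coeff_homogeneousComponent] using congrArg (coeff x) (h _ hx)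

lemma mem_pow_idealOfVars_of_isHomogeneous {f : MvPolynomial σ R} {d : ℕ}
    (hf : f.IsHomogeneous d) : f ∈ idealOfVars σ R ^ d :=
  (mem_pow_idealOfVars_iff' d f).2 fun _ hx => hf.coeff_eq_zero hx.ne

lemma isHomogeneous_det {R ι : Type*} [CommRing R] [Fintype ι] [DecidableEq ι]
    {A : Matrix ι ι (MvPolynomial σ R)} {d : ℕ} (hA : ∀ i j, (A i j).IsHomogeneous d) :
    A.det.IsHomogeneous (Fintype.card ι * d) := by
  rw [Matrix.det_apply, ← mem_homogeneousSubmodule]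
  refine sum_mem fun τ _ => Submodule.smul_of_tower_mem _ _ ?_
  simpa using IsHomogeneous.prod Finset.univ _ (fun _ => d) fun i _ => hA (τ i) i

variable [Fintype σ]

/-- The linear form `∑ aᵢ xᵢ` with coefficient vector `a`, used to pass between hyperplanes and
rows of matrices. -/
def linearForm (a : σ → R) : MvPolynomial σ R :=
  ∑ i, a i • X i

@[simp]
lemma eval_linearForm (a v : σ → R) : eval v (linearForm a) = a ⬝ᵥ v := by
  simp [linearForm, dotProduct, smul_eval]

lemma isHomogeneous_linearForm (a : σ → R) : (linearForm a).IsHomogeneous 1 :=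
  sum_mem (S := homogeneousSubmodule σ R 1)
    fun i _ => Submodule.smul_mem _ _ (isHomogeneous_X R i)

@[simp]
lemma pderiv_linearForm (a : σ → R) (j : σ) : pderiv j (linearForm a) = C (a j) := by
  classical
  simp [linearForm, pderiv_X, Pi.single_apply, smul_eq_C_mul]

lemma eval_pderiv_linearForm_mul (a b v : σ → R) (j : σ) :
    eval v (pderiv j (linearForm a * linearForm b)) = a j * (b ⬝ᵥ v) + b j * (a ⬝ᵥ v) := by
  simp [Derivation.leibniz, add_comm, mul_comm]

lemma exists_linearForm_eq {f : MvPolynomial σ R} (hf : f.IsHomogeneous 1) :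
    ∃ a, linearForm a = f := by
  rw [← mem_homogeneousSubmodule, homogeneousSubmodule_one_eq_span_X] at hf
  exact (Submodule.mem_span_range_iff_exists_fun R).1 hf

end HomogeneousPolynomials

section PointIdeals

attribute [local instance] MvPolynomial.gradedAlgebra

variable {k : Type*} [Field k] {n : ℕ} {Γ : Finset (ℙ k (Fin (n + 1) → k))}
  {f : MvPolynomial (Fin (n + 1)) k}

lemma eval_rep_eq_zero_of_mem_pointIdeal {p : ℙ k (Fin (n + 1) → k)} (hf : f ∈ pointIdeal p) :
    eval p.rep f = 0 := by
  have h : pointIdeal p ≤ RingHom.ker (eval p.rep) := Ideal.span_le.2 fun g hg => hg.2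
  exact h hf

lemma mem_definingIdeal : f ∈ definingIdeal Γ ↔ ∀ p ∈ Γ, f ∈ pointIdeal p := by
  simp [definingIdeal, Submodule.mem_iInf]

lemma mem_definingIdeal_iff_eval_rep {d : ℕ} (hf : f.IsHomogeneous d) :
    f ∈ definingIdeal Γ ↔ ∀ p ∈ Γ, eval p.rep f = 0 :=
  mem_definingIdeal.trans
    ⟨fun h p hp => eval_rep_eq_zero_of_mem_pointIdeal (h p hp),
      fun h p hp => Ideal.subset_span ⟨⟨d, hf⟩, h p hp⟩⟩

lemma homogeneousComponent_mem_definingIdeal (hf : f ∈ definingIdeal Γ) (d : ℕ) :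
    homogeneousComponent d f ∈ definingIdeal Γ :=
  mem_definingIdeal.2 fun p hp => homogeneousComponent_mem_of_mem
    (Ideal.homogeneous_span (homogeneousSubmodule (Fin (n + 1)) k) _ fun _ hg => hg.1)
    (mem_definingIdeal.1 hf p hp) d

end PointIdeals

section Separators

variable {k : Type*} [Field k] {n : ℕ}

/-- A separator of the point `p` from the set of points `S`, of degree `d`: a form of degree `d`
that vanishes on `S` but not at `p`, normalized to be `1` at the representative `p.rep`. -/
structure IsSeparator (S : Set (ℙ k (Fin (n + 1) → k))) (p : ℙ k (Fin (n + 1) → k)) (d : ℕ)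
    (f : MvPolynomial (Fin (n + 1)) k) : Prop where
  isHomogeneous : f.IsHomogeneous d
  eval_rep_self : eval p.rep f = 1
  eval_rep_eq_zero : ∀ q ∈ S, eval q.rep f = 0

lemma isSeparator_inv_mul {S : Set (ℙ k (Fin (n + 1) → k))} {p : ℙ k (Fin (n + 1) → k)} {d : ℕ}
    {f : MvPolynomial (Fin (n + 1)) k} (hf : f.IsHomogeneous d) (hp : eval p.rep f ≠ 0)
    (hS : ∀ q ∈ S, eval q.rep f = 0) : IsSeparator S p d (C (eval p.rep f)⁻¹ * f) where
  isHomogeneous := hf.C_mul _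
  eval_rep_self := by simp [hp]
  eval_rep_eq_zero q hq := by simp [hS q hq]

lemma isSeparator_one (p : ℙ k (Fin (n + 1) → k)) : IsSeparator ∅ p 0 1 :=
  ⟨isHomogeneous_one _ _, by simp, by simp⟩

lemma exists_isSeparator_empty_one (p : ℙ k (Fin (n + 1) → k)) : ∃ h, IsSeparator ∅ p 1 h := by
  obtain ⟨i, hi⟩ := Function.ne_iff.1 p.rep_nonzero
  exact ⟨_, isSeparator_inv_mul (isHomogeneous_X k i) (by simpa using hi) (by simp)⟩

lemma IsSeparator.mul {S T : Set (ℙ k (Fin (n + 1) → k))} {p : ℙ k (Fin (n + 1) → k)} {d e : ℕ}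
    {f g : MvPolynomial (Fin (n + 1)) k} (hf : IsSeparator S p d f) (hg : IsSeparator T p e g) :
    IsSeparator (S ∪ T) p (d + e) (f * g) where
  isHomogeneous := hf.isHomogeneous.mul hg.isHomogeneous
  eval_rep_self := by simp [hf.eval_rep_self, hg.eval_rep_self]
  eval_rep_eq_zero q hq := by
    rcases hq with hq | hq
    · simp [hf.eval_rep_eq_zero q hq]
    · simp [hg.eval_rep_eq_zero q hq]

variable {Γ : Finset (ℙ k (Fin (n + 1) → k))} {d : ℕ}

lemma IsSeparator.mul_mem_definingIdeal {p : ℙ k (Fin (n + 1) → k)} {e : ℕ}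
    {f g : MvPolynomial (Fin (n + 1)) k} (hf : IsSeparator (↑Γ \ {p}) p d f)
    (hg : g.IsHomogeneous e) (hgp : eval p.rep g = 0) : f * g ∈ definingIdeal Γ := by
  refine (mem_definingIdeal_iff_eval_rep (hf.isHomogeneous.mul hg)).2 fun q hq => ?_
  by_cases hqp : q = p
  · simp [hqp, hgp]
  · simp [hf.eval_rep_eq_zero q ⟨hq, hqp⟩]

lemma sub_interpolation_mem_definingIdeal
    {e : ℙ k (Fin (n + 1) → k) → MvPolynomial (Fin (n + 1)) k}
    (he : ∀ p ∈ Γ, IsSeparator (↑Γ \ {p}) p d (e p)) {f : MvPolynomial (Fin (n + 1)) k}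
    (hf : f.IsHomogeneous d) : f - ∑ p ∈ Γ, C (eval p.rep f) * e p ∈ definingIdeal Γ := by
  refine (mem_definingIdeal_iff_eval_rep (hf.sub
    (IsHomogeneous.sum _ _ _ fun p hp => (he p hp).isHomogeneous.C_mul _))).2 fun q hq => ?_
  rw [map_sub, map_sum, Finset.sum_eq_single_of_mem q hq fun p hp hpq => by
    simp [(he p hp).eval_rep_eq_zero q ⟨hq, hpq.symm⟩]]
  simp [(he q hq).eval_rep_self]

lemma pow_idealOfVars_le_sup {I : Ideal (MvPolynomial (Fin (n + 1)) k)}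
    (hI : ∀ p ∈ Γ, ∃ e ∈ I, IsSeparator (↑Γ \ {p}) p d e) :
    idealOfVars (Fin (n + 1)) k ^ d ≤ definingIdeal Γ ⊔ I := by
  choose! e heI he using hI
  rw [pow_idealOfVars_eq_span, Ideal.span_le]
  rintro _ ⟨x, hx, rfl⟩
  have hsum : ∑ p ∈ Γ, C (eval p.rep (monomial x (1 : k))) * e p ∈ I :=
    Ideal.sum_mem _ fun p hp => Ideal.mul_mem_left _ _ (heI p hp)
  simpa using add_mem (Ideal.mem_sup_left
    (sub_interpolation_mem_definingIdeal he (isHomogeneous_monomial (1 : k) hx)))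
    (Ideal.mem_sup_right hsum)

/-- Induction on `j`: for a linear form `ℓ` and a form `g`, the remainder of `g * ℓ` is `ℓ` times
the remainder of `g`, plus a combination of the `e p * (ℓ - ℓ(p) * h p) * h p ^ (j + 1)`. -/
lemma sub_interpolation_mem_definingIdeal_mul_pow
    {e h : ℙ k (Fin (n + 1) → k) → MvPolynomial (Fin (n + 1)) k}
    (he : ∀ p ∈ Γ, IsSeparator (↑Γ \ {p}) p d (e p)) (hh : ∀ p ∈ Γ, IsSeparator ∅ p 1 (h p))
    (j : ℕ) {f : MvPolynomial (Fin (n + 1)) k} (hf : f.IsHomogeneous (d + 1 + j)) :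
    f - ∑ p ∈ Γ, C (eval p.rep f) * (e p * h p ^ (j + 1)) ∈
      definingIdeal Γ * idealOfVars (Fin (n + 1)) k ^ j := by
  induction j generalizing f with
  | zero =>
    rw [pow_zero, Ideal.one_eq_top, Ideal.mul_top]
    exact sub_interpolation_mem_definingIdeal
      (fun p hp => by simpa using (he p hp).mul (hh p hp)) hf
  | succ j ih =>
    rw [← mem_homogeneousSubmodule, ← add_assoc, ← homogeneousSubmodule_one_pow, pow_succ,
      homogeneousSubmodule_one_pow] at hf
    refine Submodule.mul_induction_on hf (fun g hg l hl => ?_) fun f₁ f₂ h₁ h₂ => ?_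
    · have hsplit : g * l - ∑ p ∈ Γ, C (eval p.rep (g * l)) * (e p * h p ^ (j + 1 + 1)) =
          (g - ∑ p ∈ Γ, C (eval p.rep g) * (e p * h p ^ (j + 1))) * l +
          ∑ p ∈ Γ, C (eval p.rep g) *
            (e p * (l - C (eval p.rep l) * h p) * h p ^ (j + 1)) := by
        rw [sub_mul, sub_add, sub_right_inj, Finset.sum_mul, ← Finset.sum_sub_distrib]
        refine Finset.sum_congr rfl fun p _ => ?_
        rw [map_mul, map_mul]
        ring
      have hpow {f : MvPolynomial (Fin (n + 1)) k} (hf : f.IsHomogeneous 1) (i : ℕ) :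
          f ^ i ∈ idealOfVars (Fin (n + 1)) k ^ i := by
        simpa using mem_pow_idealOfVars_of_isHomogeneous (hf.pow i)
      rw [hsplit]
      refine add_mem ?_ (Ideal.sum_mem _ fun p hp => Ideal.mul_mem_left _ _
        (Ideal.mul_mem_mul ?_ (hpow (hh p hp).isHomogeneous _)))
      · rw [pow_succ, ← mul_assoc]
        exact Ideal.mul_mem_mul (ih hg) (by simpa using hpow hl 1)
      · exact (he p hp).mul_mem_definingIdeal
          (IsHomogeneous.sub hl ((hh p hp).isHomogeneous.C_mul _))
          (by simp [(hh p hp).eval_rep_self])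
    · convert add_mem h₁ h₂ using 1
      simp only [map_add, add_mul, Finset.sum_add_distrib]
      ring

lemma mem_definingIdeal_mul_pow (he : ∀ p ∈ Γ, ∃ e, IsSeparator (↑Γ \ {p}) p d e) {j : ℕ}
    {f : MvPolynomial (Fin (n + 1)) k} (hf : f.IsHomogeneous (d + 1 + j))
    (hfJ : f ∈ definingIdeal Γ) :
    f ∈ definingIdeal Γ * idealOfVars (Fin (n + 1)) k ^ j := by
  choose! e he using he
  choose h hh using exists_isSeparator_empty_one (k := k) (n := n)
  have hf0 := (mem_definingIdeal_iff_eval_rep hf).1 hfJ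
  have hmem := sub_interpolation_mem_definingIdeal_mul_pow he (fun p _ => hh p) j hf
  rwa [Finset.sum_eq_zero fun p hp => by rw [hf0 p hp, map_zero, zero_mul], sub_zero] at hmem

lemma definingIdeal_inf_pow_le (he : ∀ p ∈ Γ, ∃ e, IsSeparator (↑Γ \ {p}) p d e) (j : ℕ) :
    definingIdeal Γ ⊓ idealOfVars (Fin (n + 1)) k ^ (d + 1 + j) ≤
      definingIdeal Γ * idealOfVars (Fin (n + 1)) k ^ j := by
  rintro f ⟨hfJ, hfm⟩
  rw [← sum_homogeneousComponent f]
  refine Ideal.sum_mem _ fun i _ => ?_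
  obtain hi | hi := lt_or_ge i (d + 1 + j)
  · rw [mem_pow_idealOfVars_iff_homogeneousComponent.1 hfm i hi]
    exact zero_mem _
  · obtain ⟨l, rfl⟩ := Nat.exists_eq_add_of_le hi
    refine Ideal.mul_mono_right (Ideal.pow_le_pow_right (Nat.le_add_right j l))
      (mem_definingIdeal_mul_pow he ?_ (homogeneousComponent_mem_definingIdeal hfJ _))
    simpa only [← add_assoc] using homogeneousComponent_isHomogeneous (d + 1 + j + l) f

end Separators

section GeneralPosition

variable {k : Type*} [Field k] {n : ℕ} {Γ : Finset (ℙ k (Fin (n + 1) → k))}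

lemma InGeneralLinearPosition.eq_zero_of_dotProduct_eq_zero (hΓ : InGeneralLinearPosition Γ)
    {S : Finset (ℙ k (Fin (n + 1) → k))} (hS : S ⊆ Γ) (hcard : S.card = n + 1)
    {a : Fin (n + 1) → k} (ha : ∀ p ∈ S, a ⬝ᵥ p.rep = 0) : a = 0 := by
  have hle := Finset.card_le_card hS
  obtain ⟨h, -⟩ | ⟨-, h⟩ := hΓ
  · omega
  by_contra hne
  refine h S hS hcard ⟨dotProductEquiv k (Fin (n + 1)) a, by simpa using hne, fun p hp => ?_⟩
  rw [Projectivization.submodule_eq, Submodule.span_singleton_le_iff_mem]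
  simpa using ha p hp

lemma InGeneralLinearPosition.definingIdeal_le_sq (hΓ : InGeneralLinearPosition Γ)
    (hn : n + 1 ≤ Γ.card) : definingIdeal Γ ≤ idealOfVars (Fin (n + 1)) k ^ 2 := by
  intro f hf
  have hom (d : ℕ) := homogeneousComponent_isHomogeneous d f
  have heval (d : ℕ) : ∀ q ∈ Γ, eval q.rep (homogeneousComponent d f) = 0 :=
    (mem_definingIdeal_iff_eval_rep (hom d)).1 (homogeneousComponent_mem_definingIdeal hf d)
  obtain ⟨S, hS, hSn⟩ := Finset.exists_subset_card_eq hn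
  rw [mem_pow_idealOfVars_iff_homogeneousComponent]
  intro d hd
  interval_cases d
  · obtain ⟨p, hp⟩ : Γ.Nonempty := Finset.card_pos.1 (by omega)
    simpa using heval 0 p hp
  · obtain ⟨a, ha⟩ := exists_linearForm_eq (hom 1)
    have ha0 : a = 0 := hΓ.eq_zero_of_dotProduct_eq_zero hS hSn fun q hq => by
      rw [← eval_linearForm, ha, heval 1 q (hS hq)]
    simp [← ha, ha0, linearForm]

lemma InGeneralLinearPosition.exists_dotProduct_eq_one (hΓ : InGeneralLinearPosition Γ)
    (hn : n + 1 ≤ Γ.card) {S : Finset (ℙ k (Fin (n + 1) → k))} (hS : S ⊆ Γ)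
    (hcard : S.card ≤ n) {p : ℙ k (Fin (n + 1) → k)} (hp : p ∈ Γ) (hpS : p ∉ S) :
    ∃ a : Fin (n + 1) → k, a ⬝ᵥ p.rep = 1 ∧ ∀ q ∈ S, a ⬝ᵥ q.rep = 0 := by
  classical
  obtain ⟨T, hST, hT, hTn⟩ := Finset.exists_subsuperset_card_eq
    (Finset.subset_erase.2 ⟨hS, hpS⟩) hcard (by rw [Finset.card_erase_of_mem hp]; omega)
  obtain ⟨a, ha0, haT⟩ : ∃ a : Fin (n + 1) → k, a ≠ 0 ∧ ∀ q ∈ T, a ⬝ᵥ q.rep = 0 := by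
    let φ : (Fin (n + 1) → k) →ₗ[k] (T → k) :=
      LinearMap.pi fun q => dotProductEquiv k (Fin (n + 1)) q.1.rep
    obtain ⟨a, ha, ha0⟩ := (Submodule.ne_bot_iff _).1
      (LinearMap.ker_ne_bot_of_finrank_lt (f := φ) (by simp [hTn]))
    refine ⟨a, ha0, fun q hq => ?_⟩
    rw [dotProduct_comm]
    simpa [φ] using congrFun (LinearMap.mem_ker.1 ha) ⟨q, hq⟩
  have hap : a ⬝ᵥ p.rep ≠ 0 := fun h => ha0 <|
    hΓ.eq_zero_of_dotProduct_eq_zero (S := insert p T)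
      (Finset.insert_subset hp (hT.trans (Finset.erase_subset _ _)))
      (by rw [Finset.card_insert_of_notMem fun h => Finset.notMem_erase p Γ (hT h), hTn])
      (by simpa [h] using haT)
  exact ⟨(a ⬝ᵥ p.rep)⁻¹ • a, by simp [hap], fun q hq => by simp [haT q (hST hq)]⟩

lemma InGeneralLinearPosition.exists_isSeparator_of_card_le (hΓ : InGeneralLinearPosition Γ)
    (hn : n + 1 ≤ Γ.card) {p : ℙ k (Fin (n + 1) → k)} (hp : p ∈ Γ) {d : ℕ}
    {S : Finset (ℙ k (Fin (n + 1) → k))} (hS : S ⊆ Γ) (hpS : p ∉ S) (hcard : S.card ≤ d * n) :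
    ∃ f, IsSeparator S p d f := by
  classical
  induction d generalizing S with
  | zero =>
    obtain rfl : S = ∅ := by simpa using hcard
    exact ⟨1, by simpa using isSeparator_one p⟩
  | succ d ih =>
    obtain ⟨T, hTS, hT⟩ := Finset.exists_subset_card_eq (min_le_right n S.card)
    obtain ⟨a, hap, haT⟩ := hΓ.exists_dotProduct_eq_one hn (hTS.trans hS)
      (hT.trans_le (min_le_left _ _)) hp fun h => hpS (hTS h)
    have hcard' : (S \ T).card ≤ d * n := by
      rw [Finset.card_sdiff_of_subset hTS, hT]
      rw [Nat.succ_mul] at hcard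
      omega
    obtain ⟨f, hf⟩ := ih (Finset.sdiff_subset.trans hS) (by simp [hpS]) hcard'
    have ha : IsSeparator T p 1 (linearForm a) :=
      ⟨isHomogeneous_linearForm a, by simpa using hap, by simpa using haT⟩
    have hfa := hf.mul ha
    rw [← Finset.coe_union, Finset.sdiff_union_of_subset hTS] at hfa
    exact ⟨_, hfa⟩

lemma InGeneralLinearPosition.exists_isSeparator (hΓ : InGeneralLinearPosition Γ)
    (hn : n + 1 ≤ Γ.card) {d : ℕ} (hd : Γ.card ≤ d * n + 1) {p : ℙ k (Fin (n + 1) → k)}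
    (hp : p ∈ Γ) : ∃ f, IsSeparator (↑Γ \ {p}) p d f := by
  classical
  have hcard : (Γ.erase p).card ≤ d * n := by
    rw [Finset.card_erase_of_mem hp]
    omega
  simpa using hΓ.exists_isSeparator_of_card_le hn hp (Finset.erase_subset p Γ)
    (Finset.notMem_erase p Γ) hcard

end GeneralPosition

section BorderedJacobian

variable {R : Type*} [CommRing R] {n : ℕ}

/-- The Jacobian determinant of `n` polynomials in `n + 1` variables, made square by the constant
row `c`: a combination of the `n`-minors of their Jacobian matrix. -/
def borderedJacobian (c : Fin (n + 1) → R) (Q : Fin n → MvPolynomial (Fin (n + 1)) R) :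
    MvPolynomial (Fin (n + 1)) R :=
  (Matrix.of (Matrix.vecCons (fun j => C (c j)) fun s j => pderiv j (Q s))).det

variable {c : Fin (n + 1) → R} {Q : Fin n → MvPolynomial (Fin (n + 1)) R}

lemma eval_borderedJacobian (v : Fin (n + 1) → R) :
    eval v (borderedJacobian c Q) =
      (Matrix.of (Matrix.vecCons c fun s j => eval v (pderiv j (Q s)))).det := by
  rw [borderedJacobian, RingHom.map_det]
  congr 1
  ext i j
  cases i using Fin.cases <;> simp

lemma borderedJacobian_eq_sum :
    borderedJacobian c Q = ∑ j : Fin (n + 1), C ((-1) ^ (j : ℕ) * c j) *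
      (Matrix.of fun s t => pderiv (j.succAbove t) (Q s)).det := by
  rw [borderedJacobian, Matrix.det_succ_row_zero]
  refine Finset.sum_congr rfl fun j _ => ?_
  simp only [Matrix.of_apply, Matrix.cons_val_zero, map_mul, map_pow, map_neg, map_one]
  rfl

lemma borderedJacobian_mem {ι : Type*} {g : ι → MvPolynomial (Fin (n + 1)) R}
    (hQ : ∀ s, Q s ∈ Ideal.span (Set.range g)) :
    borderedJacobian c Q ∈ Ideal.span (Set.range g) ⊔ minorsIdeal n (jacobianMatrix g) := by
  rw [borderedJacobian_eq_sum]
  exact Ideal.sum_mem _ fun j _ => Ideal.mul_mem_left _ _ (det_pderiv_mem g hQ _)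

lemma isHomogeneous_borderedJacobian {d : ℕ} (hQ : ∀ s, (Q s).IsHomogeneous (d + 1)) :
    (borderedJacobian c Q).IsHomogeneous (n * d) := by
  rw [borderedJacobian_eq_sum]
  refine IsHomogeneous.sum _ _ _ fun j _ => IsHomogeneous.C_mul ?_ _
  simpa using isHomogeneous_det (A := Matrix.of fun s t => pderiv (j.succAbove t) (Q s))
    fun s t => (hQ s).pderiv

lemma eval_borderedJacobian_eq_zero_of_singular {v : Fin (n + 1) → R} {s : Fin n}
    (hs : ∀ j, eval v (pderiv j (Q s)) = 0) : eval v (borderedJacobian c Q) = 0 := by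
  rw [eval_borderedJacobian]
  exact Matrix.det_eq_zero_of_row_eq_zero s.succ fun j => by simpa using hs j

/-- By Euler's formula, `v` is in the kernel of the matrix. -/
lemma eval_borderedJacobian_eq_zero_of_eval_eq_zero [IsDomain R] {d : ℕ} {v : Fin (n + 1) → R}
    (hv : v ≠ 0) (hc : c ⬝ᵥ v = 0) (hQ : ∀ s, (Q s).IsHomogeneous d)
    (hQv : ∀ s, eval v (Q s) = 0) : eval v (borderedJacobian c Q) = 0 := by
  rw [eval_borderedJacobian, ← Matrix.exists_mulVec_eq_zero_iff]
  refine ⟨v, hv, funext fun i => ?_⟩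
  cases i using Fin.cases with
  | zero => simpa [Matrix.mulVec] using hc
  | succ s =>
    have euler := congrArg (eval v) (hQ s).sum_X_mul_pderiv
    simpa [Matrix.mulVec, dotProduct, hQv s, mul_comm] using euler

lemma isUnit_det_vecCons {v : Fin (n + 1) → R} {a w : Fin n → Fin (n + 1) → R}
    (hcv : c ⬝ᵥ v = 1) (hav : ∀ s, a s ⬝ᵥ v = 0)
    (haw : ∀ s t, a s ⬝ᵥ w t = if s = t then 1 else 0) :
    IsUnit (Matrix.of (Matrix.vecCons c a)).det := by
  let A := Matrix.of (Matrix.vecCons c a)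
  let B := Matrix.of (Matrix.vecCons v w)
  have htri : (A * B.transpose).BlockTriangular id := by
    intro i j hij
    cases i using Fin.cases with
    | zero => exact absurd hij (Fin.not_lt_zero j)
    | succ s =>
      cases j using Fin.cases with
      | zero => exact hav s
      | succ t =>
        have hts : t < s := by simpa using hij
        exact (haw s t).trans (if_neg hts.ne')
  have hdiag (i) : (A * B.transpose) i i = 1 := by
    cases i using Fin.cases with
    | zero => exact hcv
    | succ s => exact (haw s s).trans (if_pos rfl)
  refine IsUnit.of_mul_eq_one B.det ?_
  rw [← Matrix.det_transpose B, ← Matrix.det_mul, Matrix.det_of_isUpperTriangular htri]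
  simp [hdiag]

lemma isUnit_eval_borderedJacobian {v : Fin (n + 1) → R} {a b w : Fin n → Fin (n + 1) → R}
    (hcv : c ⬝ᵥ v = 1) (hav : ∀ s, a s ⬝ᵥ v = 0) (hbv : ∀ s, b s ⬝ᵥ v = 1)
    (haw : ∀ s t, a s ⬝ᵥ w t = if s = t then 1 else 0) :
    IsUnit (eval v (borderedJacobian c fun s => linearForm (a s) * linearForm (b s))) := by
  rw [eval_borderedJacobian]
  simpa [eval_pderiv_linearForm_mul, hav, hbv] using isUnit_det_vecCons hcv hav haw

lemma isSeparator_borderedJacobian {k : Type*} [Field k] {c : Fin (n + 1) → k}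
    {Q : Fin n → MvPolynomial (Fin (n + 1)) k} {d : ℕ} (hQ : ∀ s, (Q s).IsHomogeneous (d + 1))
    {S : Set (ℙ k (Fin (n + 1) → k))} {p : ℙ k (Fin (n + 1) → k)}
    (hp : eval p.rep (borderedJacobian c Q) ≠ 0)
    (hS : ∀ q ∈ S, (c ⬝ᵥ q.rep = 0 ∧ ∀ s, eval q.rep (Q s) = 0) ∨
      ∃ s, ∀ j, eval q.rep (pderiv j (Q s)) = 0) :
    IsSeparator S p (n * d)
      (C (eval p.rep (borderedJacobian c Q))⁻¹ * borderedJacobian c Q) := by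
  refine isSeparator_inv_mul (isHomogeneous_borderedJacobian hQ) hp fun q hq => ?_
  obtain ⟨hc, hQq⟩ | ⟨s, hs⟩ := hS q hq
  · exact eval_borderedJacobian_eq_zero_of_eval_eq_zero q.rep_nonzero hc hQ hQq
  · exact eval_borderedJacobian_eq_zero_of_singular hs

end BorderedJacobian

section JacobianIdeal

variable {k : Type*} [Field k] {n : ℕ} {Γ : Finset (ℙ k (Fin (n + 1) → k))}
  {p : ℙ k (Fin (n + 1) → k)}

lemma InGeneralLinearPosition.exists_dual_family (hΓ : InGeneralLinearPosition Γ)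
    (hn : n + 1 ≤ Γ.card) (hp : p ∈ Γ) {u : Fin n → ℙ k (Fin (n + 1) → k)}
    (hu : Function.Injective u) (huΓ : ∀ s, u s ∈ Γ) (hup : ∀ s, u s ≠ p) :
    ∃ a : Fin n → Fin (n + 1) → k, (∀ s, a s ⬝ᵥ p.rep = 0) ∧
      ∀ s t, a s ⬝ᵥ (u t).rep = if s = t then 1 else 0 := by
  classical
  have hdual (s : Fin n) : ∃ a : Fin (n + 1) → k, a ⬝ᵥ (u s).rep = 1 ∧
      ∀ q ∈ insert p ((Finset.univ.erase s).image u), a ⬝ᵥ q.rep = 0 := by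
    refine hΓ.exists_dotProduct_eq_one hn ?_ ?_ (huΓ s) ?_
    · simpa [Finset.insert_subset_iff, hp, Finset.image_subset_iff] using fun t _ => huΓ t
    · calc (insert p ((Finset.univ.erase s).image u)).card
          ≤ ((Finset.univ.erase s).image u).card + 1 := Finset.card_insert_le _ _
        _ ≤ (Finset.univ.erase s).card + 1 := by gcongr; exact Finset.card_image_le
        _ = n := by rw [Finset.card_erase_add_one (Finset.mem_univ s), Finset.card_fin]
    · simp [hup s, hu.eq_iff]
  choose a ha1 ha0 using hdual
  refine ⟨a, fun s => ha0 s p (Finset.mem_insert_self _ _), fun s t => ?_⟩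
  split_ifs with hst
  · rw [← hst, ha1]
  · exact ha0 s _ (Finset.mem_insert_of_mem
      (Finset.mem_image_of_mem u (by simpa using Ne.symm hst)))

lemma exists_injective_fin_cover {α : Type*} {S : Finset α} (hn : n ≤ S.card) :
    ∃ (u : Fin n → α) (W : Finset α), Function.Injective u ∧ (∀ s, u s ∈ S) ∧ W ⊆ S ∧
      W.card = S.card - n ∧ ∀ q ∈ S, q ∈ W ∨ ∃ s, u s = q := by
  classical
  obtain ⟨U, hU, hUn⟩ := Finset.exists_subset_card_eq hn
  let e := Finset.equivFinOfCardEq hUn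
  refine ⟨fun s => e.symm s, S \ U, Subtype.coe_injective.comp e.symm.injective,
    fun s => hU (e.symm s).2, Finset.sdiff_subset, by rw [Finset.card_sdiff_of_subset hU, hUn],
    fun q hq => ?_⟩
  by_cases hqU : q ∈ U
  · exact Or.inr ⟨e ⟨q, hqU⟩, by simp⟩
  · exact Or.inl (Finset.mem_sdiff.2 ⟨hq, hqU⟩)

/-- The points `u t` are `n` of the points other than `p`; by `|Γ| < 2n` at most `n - 2` others
remain, so `b s` can be made to vanish on those, at `u s` and at the point cyclically next to it. -/
lemma InGeneralLinearPosition.exists_linearForms (hΓ : InGeneralLinearPosition Γ)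
    (hn : n + 1 ≤ Γ.card) (hcard : Γ.card < 2 * n) (hp : p ∈ Γ) :
    ∃ (c : Fin (n + 1) → k) (a b : Fin n → Fin (n + 1) → k) (u : Fin n → ℙ k (Fin (n + 1) → k)),
      c ⬝ᵥ p.rep = 1 ∧ (∀ s, a s ⬝ᵥ p.rep = 0) ∧ (∀ s, b s ⬝ᵥ p.rep = 1) ∧
      (∀ s t, a s ⬝ᵥ (u t).rep = if s = t then 1 else 0) ∧
      ∀ q ∈ Γ, q ≠ p → (c ⬝ᵥ q.rep = 0 ∧ ∀ s, b s ⬝ᵥ q.rep = 0) ∨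
        ∃ t, u t = q ∧ b t ⬝ᵥ q.rep = 0 ∧ ∃ s ≠ t, b s ⬝ᵥ q.rep = 0 := by
  classical
  have hcardp := Finset.card_erase_of_mem hp
  obtain ⟨u, W, hu, huΓ, hWΓ, hWcard, hcover⟩ :=
    exists_injective_fin_cover (n := n) (S := Γ.erase p) (by omega)
  have hpW : p ∉ W := fun h => Finset.notMem_erase p Γ (hWΓ h)
  replace hWΓ : W ⊆ Γ := hWΓ.trans (Finset.erase_subset _ _)
  have hup (s) : u s ≠ p := Finset.ne_of_mem_erase (huΓ s)
  replace huΓ (s) : u s ∈ Γ := Finset.mem_of_mem_erase (huΓ s)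
  let o := finRotate n
  have ho (s) : o s ≠ s := by
    rw [← Equiv.Perm.mem_support, support_finRotate_of_le (by omega)]
    exact Finset.mem_univ s
  obtain ⟨c, hcp, hcW⟩ := hΓ.exists_dotProduct_eq_one hn hWΓ (by omega) hp hpW
  obtain ⟨a, hap, hau⟩ := hΓ.exists_dual_family hn hp hu huΓ hup
  have hb (s : Fin n) : ∃ b : Fin (n + 1) → k, b ⬝ᵥ p.rep = 1 ∧
      ∀ q ∈ insert (u s) (insert (u (o s)) W), b ⬝ᵥ q.rep = 0 := by
    refine hΓ.exists_dotProduct_eq_one hn ?_ ?_ hp ?_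
    · simp [Finset.insert_subset_iff, huΓ, hWΓ]
    · grind [Finset.card_insert_le]
    · simp [hpW, (hup _).symm]
  choose b hbp hb0 using hb
  refine ⟨c, a, b, u, hcp, hap, hbp, hau, fun q hq hqp => ?_⟩
  refine (hcover q (Finset.mem_erase.2 ⟨hqp, hq⟩)).imp
    (fun hqW => ⟨hcW q hqW, fun s => hb0 s q (by simp [hqW])⟩) ?_
  rintro ⟨t, rfl⟩
  exact ⟨t, rfl, hb0 t _ (by simp), o.symm t, by simpa using (ho (o.symm t)).symm,
    hb0 _ _ (by simp)⟩

lemma InGeneralLinearPosition.exists_quadrics (hΓ : InGeneralLinearPosition Γ)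
    (hn : n + 1 ≤ Γ.card) (hcard : Γ.card < 2 * n) (hp : p ∈ Γ) :
    ∃ (c : Fin (n + 1) → k) (Q : Fin n → MvPolynomial (Fin (n + 1)) k),
      (∀ s, (Q s).IsHomogeneous 2) ∧ (∀ s, Q s ∈ definingIdeal Γ) ∧
      eval p.rep (borderedJacobian c Q) ≠ 0 ∧
      ∀ q ∈ Γ, q ≠ p → c ⬝ᵥ q.rep = 0 ∨ ∃ s, ∀ j, eval q.rep (pderiv j (Q s)) = 0 := by
  obtain ⟨c, a, b, u, hcp, hap, hbp, hau, hΓp⟩ := hΓ.exists_linearForms hn hcard hp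
  have hQ (s) : (linearForm (a s) * linearForm (b s)).IsHomogeneous 2 :=
    (isHomogeneous_linearForm _).mul (isHomogeneous_linearForm _)
  refine ⟨c, fun s => linearForm (a s) * linearForm (b s), hQ, fun s => ?_,
    (isUnit_eval_borderedJacobian hcp hap hbp hau).ne_zero, fun q hq hqp => ?_⟩
  · refine (mem_definingIdeal_iff_eval_rep (hQ s)).2 fun q hq => ?_
    by_cases hqp : q = p
    · simp [hqp, hap]
    obtain ⟨-, hbq⟩ | ⟨t, rfl, hbt, -⟩ := hΓp q hq hqp
    · simp [hbq s]
    · obtain rfl | hst := eq_or_ne s t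
      · simp [hbt]
      · simp [hau, hst]
  · obtain ⟨hcq, -⟩ | ⟨t, rfl, -, s, hst, hbs⟩ := hΓp q hq hqp
    · exact Or.inl hcq
    · exact Or.inr ⟨s, fun j => by rw [eval_pderiv_linearForm_mul, hbs, hau, if_neg hst]; simp⟩

variable {ι : Type*} {g : ι → MvPolynomial (Fin (n + 1)) k}

lemma InGeneralLinearPosition.exists_isSeparator_mem_jacobianIdeal
    (hΓ : InGeneralLinearPosition Γ) (hn : n + 1 ≤ Γ.card) (hcard : Γ.card < 2 * n)
    (hg : Ideal.span (Set.range g) = definingIdeal Γ) (hp : p ∈ Γ) :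
    ∃ f ∈ definingIdeal Γ ⊔ minorsIdeal n (jacobianMatrix g), IsSeparator (↑Γ \ {p}) p n f := by
  obtain ⟨c, Q, hQ, hQΓ, hQp, hQq⟩ := hΓ.exists_quadrics hn hcard hp
  have hmem : borderedJacobian c Q ∈ definingIdeal Γ ⊔ minorsIdeal n (jacobianMatrix g) := by
    rw [← hg] at hQΓ ⊢
    exact borderedJacobian_mem hQΓ
  have hsep := isSeparator_borderedJacobian hQ hQp (S := ↑Γ \ {p}) fun q hq =>
    (hQq q hq.1 hq.2).imp_left fun hc =>
      ⟨hc, fun s => (mem_definingIdeal_iff_eval_rep (hQ s)).1 (hQΓ s) q hq.1⟩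
  rw [mul_one] at hsep
  exact ⟨_, Ideal.mul_mem_left _ _ hmem, hsep⟩

lemma InGeneralLinearPosition.definingIdeal_sup_minorsIdeal_eq
    (hΓ : InGeneralLinearPosition Γ) (hn : n + 1 ≤ Γ.card) (hcard : Γ.card < 2 * n)
    (hg : Ideal.span (Set.range g) = definingIdeal Γ) :
    definingIdeal Γ ⊔ minorsIdeal n (jacobianMatrix g) =
      definingIdeal Γ ⊔ idealOfVars (Fin (n + 1)) k ^ n := by
  refine le_antisymm (sup_le_sup_left (minorsIdeal_le_pow (fun i j => ?_) n) _)
    (sup_le le_sup_left ?_)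
  · refine derivation_mem_of_mem_sq (pderiv j) (hΓ.definingIdeal_le_sq hn ?_)
    exact hg ▸ Ideal.subset_span (Set.mem_range_self i)
  · exact (pow_idealOfVars_le_sup fun p hp =>
      hΓ.exists_isSeparator_mem_jacobianIdeal hn hcard hg hp).trans (sup_le le_sup_left le_rfl)

end JacobianIdeal

end AluffiPoints

end

open AluffiPoints in
theorem proposition4p5_general {k : Type*} [Field k] {n : ℕ}
    {Γ : Finset (ℙ k (Fin (n + 1) → k))} (hΓ : InGeneralLinearPosition Γ)
    (hn : n + 1 ≤ Γ.card) (hcard : Γ.card < 2 * n) {ι : Type*}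
    (g : ι → MvPolynomial (Fin (n + 1)) k)
    (hg : Ideal.span (Set.range g) = definingIdeal Γ) :
    IsAluffiTorsionFree (definingIdeal Γ)
      (definingIdeal Γ ⊔ minorsIdeal n (jacobianMatrix g)) := by
  rw [hΓ.definingIdeal_sup_minorsIdeal_eq hn hcard hg]
  obtain ⟨d, rfl⟩ : ∃ d, n = d + 1 := Nat.exists_eq_succ_of_ne_zero (by omega)
  have hsep := fun p hp => hΓ.exists_isSeparator hn (d := d) (p := p) (by nlinarith) hp
  refine isAluffiTorsionFree_sup fun t => ?_
  rw [← pow_mul, ← pow_mul, mul_add_one, add_comm (_ * t)]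
  exact definingIdeal_inf_pow_le hsep _

theorem proposition4p5 {k : Type*} [Field k] [IsAlgClosed k] (n : ℕ) (hn : 4 ≤ n)
    (Γ : Finset (Projectivization k (Fin (n + 1) → k))) (hcard : Γ.card = n + 3)
    (hΓ : AluffiPoints.InGeneralLinearPosition Γ)
    (m : ℕ) (g : Fin m → MvPolynomial (Fin (n + 1)) k)
    (hg : Ideal.span (Set.range g) = AluffiPoints.definingIdeal Γ) :
    AluffiPoints.IsAluffiTorsionFree (AluffiPoints.definingIdeal Γ)
      (AluffiPoints.definingIdeal Γ ⊔
        AluffiPoints.minorsIdeal n (AluffiPoints.jacobianMatrix g)) := by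
  exact proposition4p5_general hΓ (by omega) (by omega) g hg
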